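/- Let $\{C_n\}_{n\ge 0}$ be a C-process on a probability space $(\Omega,\mathcal F,\mathbf P)$, i.e. a time-homogeneous Markov chain with values in the positive integers, with $C_0=1$ and one-step transition probabilities $p_{ij}=\frac{i}{j(j-1)}$ for $j\ge i+1$ and $p_{ij}=0$ for $j\le i$. Put $Y_n=\frac{\log C_n-n}{n}$ for $n\ge 1$, and $$I_C(x)=\begin{cases} x-\log(x+1), & x>-1,\\ +\infty, & x\le -1.\end{cases}$$ Then $\{Y_n\}_{n\ge1}$ satisfies a large deviation principle with speed $n$ and good rate function $I_C$. That is, $I_C:\mathbb R\to[0,\infty]$ is lower semicontinuous with compact level sets $\{x\in\mathbb R: I_C(x)\le a\}$, $a\in\mathbb R$, and for every Borel set $\Gamma\subseteq\mathbb R$, with interior $\Gamma^\circ$ and closure $\overline\Gamma$, $$-\inf_{x\in\Gamma^\circ}I_C(x)\le\liminf_{n\to\infty}\frac1n\log\mathbf P(Y_n\in\Gamma)\le\limsup_{n\to\infty}\frac1n\log\mathbf P(Y_n\in\Gamma)\le-\inf_{x\in\overline\Gamma}I_C(x),$$ where $\log 0=-\infty$ and $\inf\emptyset=+\infty$. -/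

import Mathlib

open MeasureTheory ProbabilityTheory Filter Topology

/-- `X` is a time-homogeneous Markov chain on the countable state space `S` with one-step
transition probabilities `p i j`: every conditional probability
`P (X (n+1) = j | X 0 = s 0, …, X n = s n)` that is defined equals `p (s n) j`. -/
structure IsMarkovChain {Ω S : Type*} [MeasurableSpace Ω] [MeasurableSpace S]
    (μ : Measure Ω) (X : ℕ → Ω → S) (p : S → S → ℝ) : Prop where
  measurable : ∀ n, Measurable (X n)
  markov : ∀ (n : ℕ) (s : ℕ → S) (j : S),
    μ {ω | ∀ k ≤ n, X k ω = s k} ≠ 0 →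
      (μ[|{ω | ∀ k ≤ n, X k ω = s k}]).real {ω | X (n + 1) ω = j} = p (s n) j

/-- The transition probabilities `i / (j (j - 1))` for `j ≥ i + 1`, and `0` for `j ≤ i`. -/
noncomputable def cTransition (i j : ℕ) : ℝ :=
  if i + 1 ≤ j then (i : ℝ) / ((j : ℝ) * ((j : ℝ) - 1)) else 0

/-- A C-process: a Markov chain started at `1` with transition probabilities `cTransition`.
The chain almost surely never visits the state `0`. -/
structure IsCProcess {Ω : Type*} [MeasurableSpace Ω] (μ : Measure Ω) (C : ℕ → Ω → ℕ) :
    Prop where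
  initial : ∀ᵐ ω ∂μ, C 0 ω = 1
  isMarkovChain : IsMarkovChain μ C cTransition

/-- A good rate function: values in `[0, ∞]`, lower semicontinuous, compact level sets. -/
structure IsGoodRateFunction (I : ℝ → EReal) : Prop where
  nonneg : ∀ x, 0 ≤ I x
  lowerSemicontinuous : LowerSemicontinuous I
  isCompact_levelSet : ∀ a : ℝ, IsCompact {x | I x ≤ (a : EReal)}

/-- The real random variables `Y n` satisfy a large deviation principle with speed `n` and good
rate function `I`. Here `log 0 = -∞` and the infimum over the empty set is `+∞`. -/
structure SatisfiesLDP {Ω : Type*} [MeasurableSpace Ω] (μ : Measure Ω) (Y : ℕ → Ω → ℝ)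
    (I : ℝ → EReal) : Prop where
  isGoodRateFunction : IsGoodRateFunction I
  bounds : ∀ Γ : Set ℝ, MeasurableSet Γ →
    -(⨅ x ∈ interior Γ, I x)
        ≤ liminf (fun n : ℕ => ENNReal.log (μ {ω | Y n ω ∈ Γ}) / (n : EReal)) atTop ∧
    liminf (fun n : ℕ => ENNReal.log (μ {ω | Y n ω ∈ Γ}) / (n : EReal)) atTop
        ≤ limsup (fun n : ℕ => ENNReal.log (μ {ω | Y n ω ∈ Γ}) / (n : EReal)) atTop ∧
    limsup (fun n : ℕ => ENNReal.log (μ {ω | Y n ω ∈ Γ}) / (n : EReal)) atTop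
        ≤ -(⨅ x ∈ closure Γ, I x)

/-- The function `x - log (x + 1)` for `x > -1`, and `+∞` for `x ≤ -1`. -/
noncomputable def rateC (x : ℝ) : EReal :=
  open Classical in
  if -1 < x then ((x - Real.log (x + 1) : ℝ) : EReal) else ⊤

/-! Write `e_k(N)` for the elementary symmetric polynomial of degree `k` in `1, 1/2, …, 1/N`
(`recipEsymm k N`). Along a path `1 < c_1 < … < c_{k+1} = N + 2` the numerators `i` of the
transition probabilities cancel against the factors `j` of the preceding denominators, leaving
`1/c_{k+1}` times the product of the `1/(c_i - 1)`. Summing over paths gives `P(C_{k+1} = N + 2) =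
e_k(N) / ((N + 2)(N + 1))` (`measureReal_eq_recipEsymm`).

Likewise the probability of crossing level `N + 2` at step `k + 1` is `e_k(N)/(N + 1)`
(`measureReal_lt_sub`), so both tails of `C_n` are sums of these numbers, over `k < n` and over `k ≥
n`.

Upper bound: the generating function `∑ e_k(N) t^k = ∏ (1 + t/m)` is at most `e^t (N + 1)^t`.
Chernoff's argument with `t ≤ 1` for the upper tail and `t ≥ 1` for the lower tail, at `N ≈
e^{n(x+1)}`, is optimal at `t = 1/(x+1)` and yields `exp(-n (x - log (x+1)))` up to a constant. A
set on which the rate is at least `a > 0` lies in the union of two such tails.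

Lower bound: comparing sums with integrals of powers of `log` gives `e_k(N) ≥ (log(N+2) - H_k)_+^k /
k!`, with `H_k` the harmonic number (`pow_div_factorial_le`). With `N ≈ e^{nu}`, `u = x + 1` and `k
= n - 1`, the window `[N + 2, 2(N + 2))` has mass at least `e_k(N)/(2(N + 2))`. Since `H_k = O(log
n)`, a Stirling-type bound gives the exponent `log v + 1 - u` for every `v < u`; let `v` tend to
`u`. -/

/-! ### One-step recursion for the marginals of a Markov chain -/

namespace IsMarkovChain

variable {Ω S : Type*} [MeasurableSpace Ω] [MeasurableSpace S] {μ : Measure Ω}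
  {X : ℕ → Ω → S} {p : S → S → ℝ}

theorem measure_cylinder_inter [IsFiniteMeasure μ] [MeasurableSingletonClass S]
    (h : IsMarkovChain μ X p) (n : ℕ) (s : ℕ → S) (j : S) :
    μ ({ω | ∀ k ≤ n, X k ω = s k} ∩ {ω | X (n + 1) ω = j}) =
      μ {ω | ∀ k ≤ n, X k ω = s k} * ENNReal.ofReal (p (s n) j) := by
  have hmeas : MeasurableSet {ω | ∀ k ≤ n, X k ω = s k} := by
    simp only [Set.ofPred_forall]
    exact MeasurableSet.iInter fun k => MeasurableSet.iInter fun _ =>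
      h.measurable k (measurableSet_singleton (s k))
  by_cases h0 : μ {ω | ∀ k ≤ n, X k ω = s k} = 0
  · rw [h0, zero_mul]
    exact measure_mono_null Set.inter_subset_left h0
  · rw [← h.markov n s j h0, ofReal_measureReal, mul_comm, cond_mul_eq_inter hmeas]

/-- The Markov property conditions on the whole history, so the event is split over the countably
many histories up to time `n`. Those ending at `i` all carry the same factor `p i j`; the others
contribute nothing. -/
theorem measure_inter_succ [IsFiniteMeasure μ] [Countable S] [MeasurableSingletonClass S]
    (h : IsMarkovChain μ X p) (n : ℕ) (i j : S) :
    μ ({ω | X n ω = i} ∩ {ω | X (n + 1) ω = j}) =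
      μ {ω | X n ω = i} * ENNReal.ofReal (p i j) := by
  let path : Ω → Fin (n + 1) → S := fun ω k => X k ω
  have hpath : Measurable path := measurable_pi_lambda _ fun k => h.measurable k
  have hsum : ∀ A : Set Ω, MeasurableSet A → μ A = ∑' s, μ (A ∩ path ⁻¹' {s}) := by
    intro A hA
    rw [← measure_iUnion, ← Set.inter_iUnion, ← Set.preimage_iUnion]
    · rw [Set.iUnion_of_singleton, Set.preimage_univ, Set.inter_univ]
    · intro s t hst
      refine Set.disjoint_left.2 ?_
      rintro ω ⟨_, h1⟩ ⟨_, h2⟩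
      exact hst (h1.symm.trans h2)
    · exact fun s => hA.inter (hpath (measurableSet_singleton s))
  have hX : ∀ m i, MeasurableSet {ω | X m ω = i} := fun m i =>
    h.measurable m (measurableSet_singleton i)
  rw [hsum _ ((hX n i).inter (hX (n + 1) j)), hsum _ (hX n i), ← ENNReal.tsum_mul_right]
  refine tsum_congr fun s => ?_
  by_cases hs : s (Fin.last n) = i
  · let s' : ℕ → S := fun k => if hk : k < n + 1 then s ⟨k, hk⟩ else i
    have hcyl : path ⁻¹' {s} = {ω | ∀ k ≤ n, X k ω = s' k} := by
      ext ω
      simp only [Set.mem_preimage, Set.mem_singleton_iff, Set.mem_ofPred_eq, funext_iff, path, s']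
      constructor
      · intro hω k hk
        rw [dif_pos (Nat.lt_succ_of_le hk)]
        exact hω ⟨k, Nat.lt_succ_of_le hk⟩
      · intro hω k
        have := hω k (Nat.le_of_lt_succ k.2)
        rwa [dif_pos k.2] at this
    have hlast : s' n = i := by
      simp only [s', Nat.lt_succ_self, dif_pos]
      exact hs
    have hsub : path ⁻¹' {s} ⊆ {ω | X n ω = i} := by
      rw [hcyl]
      intro ω hω
      exact (hω n le_rfl).trans hlast
    rw [Set.inter_right_comm, Set.inter_eq_right.2 hsub, hcyl,
      h.measure_cylinder_inter n s' j, hlast]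
  · have hempty : {ω | X n ω = i} ∩ path ⁻¹' {s} = ∅ := by
      ext ω
      simp only [Set.mem_inter_iff, Set.mem_ofPred_eq, Set.mem_preimage, Set.mem_singleton_iff,
        Set.mem_empty_iff_false, iff_false, not_and]
      rintro h1 rfl
      exact hs h1
    rw [Set.inter_right_comm, hempty]
    simp

end IsMarkovChain

/-! ### Marginals of the C-process -/

namespace IsCProcess

variable {Ω : Type*} [MeasurableSpace Ω] {μ : Measure Ω} {C : ℕ → Ω → ℕ}

theorem measurableSet_eq (hC : IsCProcess μ C) (n i : ℕ) : MeasurableSet {ω | C n ω = i} :=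
  hC.isMarkovChain.measurable n (measurableSet_singleton i)

theorem measureReal_zero [IsProbabilityMeasure μ] (hC : IsCProcess μ C) (i : ℕ) :
    μ.real {ω | C 0 ω = i} = if i = 1 then 1 else 0 := by
  split_ifs with hi
  · subst hi
    rw [measureReal_def, (prob_compl_eq_zero_iff (hC.measurableSet_eq 0 1)).1 hC.initial]
    simp
  · rw [measureReal_def, measure_mono_null (t := {ω | C 0 ω = 1}ᶜ) _ hC.initial]
    · simp
    · intro ω hω h1
      exact hi (hω.symm.trans h1)

theorem measureReal_succ [IsProbabilityMeasure μ] (hC : IsCProcess μ C) (n j : ℕ) :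
    μ.real {ω | C (n + 1) ω = j} =
      ∑ i ∈ Finset.range j, μ.real {ω | C n ω = i} * ((i : ℝ) / ((j : ℝ) * ((j : ℝ) - 1))) := by
  have h1 : μ {ω | C (n + 1) ω = j} =
      ∑' i, μ {ω | C n ω = i} * ENNReal.ofReal (cTransition i j) := by
    simp_rw [← hC.isMarkovChain.measure_inter_succ n _ j]
    rw [← measure_iUnion, ← Set.iUnion_inter]
    · congr 1
      ext ω
      simp
    · intro s t hst
      refine Set.disjoint_left.2 ?_
      rintro ω ⟨h1, _⟩ ⟨h2, _⟩
      exact hst (h1.symm.trans h2)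
    · exact fun i => (hC.measurableSet_eq n i).inter (hC.measurableSet_eq (n + 1) j)
  rw [tsum_eq_sum (s := Finset.range j)] at h1
  · rw [measureReal_def, h1, ENNReal.toReal_sum (fun i _ => by finiteness)]
    refine Finset.sum_congr rfl fun i hi => ?_
    have hij : i + 1 ≤ j := Finset.mem_range.1 hi
    have hj : (1 : ℝ) ≤ j := by exact_mod_cast le_trans (Nat.le_add_left 1 i) hij
    rw [ENNReal.toReal_mul, cTransition, if_pos hij, ENNReal.toReal_ofReal]
    · rfl
    · exact div_nonneg (Nat.cast_nonneg i)
        (mul_nonneg (Nat.cast_nonneg j) (sub_nonneg.2 hj))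
  · intro i hi
    rw [cTransition, if_neg (fun h : i + 1 ≤ j => hi (Finset.mem_range.2 h))]
    simp

theorem measureReal_lt [IsProbabilityMeasure μ] (hC : IsCProcess μ C) (n m : ℕ) :
    μ.real {ω | C n ω < m} = ∑ i ∈ Finset.range m, μ.real {ω | C n ω = i} := by
  rw [← measureReal_biUnion_finset]
  · congr 1
    ext ω
    simp
  · intro s _ t _ hst
    refine Set.disjoint_left.2 ?_
    intro ω h1 h2
    exact hst (h1.symm.trans h2)
  · exact fun i _ => hC.measurableSet_eq n i

end IsCProcess

/-! ### Elementary symmetric polynomials of reciprocals -/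

/-- The elementary symmetric polynomial of degree `k` in `1, 1/2, …, 1/N`. -/
noncomputable def recipEsymm : ℕ → ℕ → ℝ
  | 0, _ => 1
  | _ + 1, 0 => 0
  | k + 1, N + 1 => recipEsymm (k + 1) N + recipEsymm k N / (N + 1)

namespace recipEsymm

@[simp] theorem zero_left (N : ℕ) : recipEsymm 0 N = 1 := by
  unfold recipEsymm; rfl

@[simp] theorem succ_zero (k : ℕ) : recipEsymm (k + 1) 0 = 0 := by
  unfold recipEsymm; rfl

theorem succ_succ (k N : ℕ) :
    recipEsymm (k + 1) (N + 1) = recipEsymm (k + 1) N + recipEsymm k N / (N + 1) := by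
  rw [recipEsymm]

theorem nonneg (k N : ℕ) : 0 ≤ recipEsymm k N := by
  induction N generalizing k with
  | zero => cases k <;> simp
  | succ N ih =>
    cases k with
    | zero => simp
    | succ k =>
      rw [succ_succ]
      have := ih k
      have := ih (k + 1)
      positivity

theorem monotone (k : ℕ) : Monotone (recipEsymm k) := by
  refine monotone_nat_of_le_succ fun N => ?_
  cases k with
  | zero => simp
  | succ k =>
    rw [succ_succ]
    have := nonneg k N
    exact le_add_of_nonneg_right (by positivity)

theorem eq_zero_of_lt {k N : ℕ} (h : N < k) : recipEsymm k N = 0 := by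
  induction N generalizing k with
  | zero =>
    obtain ⟨k, rfl⟩ := Nat.exists_eq_succ_of_ne_zero h.ne'
    simp
  | succ N ih =>
    obtain ⟨k, rfl⟩ := Nat.exists_eq_succ_of_ne_zero (Nat.ne_zero_of_lt h)
    rw [Nat.succ_eq_add_one, succ_succ, ih (by omega), ih (by omega)]
    simp

theorem succ_eq_sum (k N : ℕ) :
    recipEsymm (k + 1) N = ∑ M ∈ Finset.range N, recipEsymm k M / (M + 1) := by
  induction N with
  | zero => simp
  | succ N ih => rw [succ_succ, ih, Finset.sum_range_succ]

theorem sum_mul_pow (t : ℝ) (N : ℕ) :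
    ∑ k ∈ Finset.range (N + 1), recipEsymm k N * t ^ k =
      ∏ m ∈ Finset.range N, (1 + t / (m + 1)) := by
  induction N with
  | zero => simp
  | succ N ih =>
    have h1 : ∑ k ∈ Finset.range (N + 2), recipEsymm k N * t ^ k =
        ∏ m ∈ Finset.range N, (1 + t / (m + 1)) := by
      rw [Finset.sum_range_succ, eq_zero_of_lt (Nat.lt_succ_self N), ih]
      simp
    rw [Finset.prod_range_succ, mul_add, mul_one]
    nth_rw 1 [← h1]
    rw [← ih, Finset.sum_range_succ' _ (N + 1), Finset.sum_range_succ' _ (N + 1), Finset.sum_mul]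
    simp only [succ_succ, zero_left]
    rw [add_right_comm, ← Finset.sum_add_distrib]
    congr 1
    refine Finset.sum_congr rfl fun k _ => ?_
    ring

/-- All terms are nonnegative and those with `k > N` vanish, so any partial sum is at most the full
product, which `1 + y ≤ e^y` and `H_N ≤ 1 + log (N + 1)` control. The freedom in `s` serves both
tails. -/
theorem sum_mul_pow_le {t : ℝ} (ht : 0 ≤ t) (N : ℕ) (s : Finset ℕ) :
    ∑ k ∈ s, recipEsymm k N * t ^ k ≤ Real.exp t * ((N : ℝ) + 1) ^ t := by
  calc ∑ k ∈ s, recipEsymm k N * t ^ k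
      ≤ ∑ k ∈ Finset.range (N + 1), recipEsymm k N * t ^ k := by
        rw [← Finset.sum_filter_add_sum_filter_not s (fun k => k < N + 1)]
        rw [Finset.sum_eq_zero (s := s.filter fun k => ¬ k < N + 1), add_zero]
        · refine Finset.sum_le_sum_of_subset_of_nonneg ?_ ?_
          · intro k hk
            exact Finset.mem_range.2 (Finset.mem_filter.1 hk).2
          · exact fun k _ _ => mul_nonneg (nonneg k N) (pow_nonneg ht k)
        · intro k hk
          rw [eq_zero_of_lt (by have := (Finset.mem_filter.1 hk).2; omega), zero_mul]
    _ = ∏ m ∈ Finset.range N, (1 + t / (m + 1)) := sum_mul_pow t N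
    _ ≤ ∏ m ∈ Finset.range N, Real.exp (t / (m + 1)) := by
        refine Finset.prod_le_prod (fun m _ => by positivity) fun m _ => ?_
        rw [add_comm]
        exact Real.add_one_le_exp _
    _ = Real.exp (t * (harmonic N : ℝ)) := by
        rw [← Real.exp_sum, harmonic, Rat.cast_sum, Finset.mul_sum]
        congr 1
        refine Finset.sum_congr rfl fun m _ => ?_
        push_cast
        rw [div_eq_mul_inv]
    _ ≤ Real.exp (t * (1 + Real.log ((N : ℝ) + 1))) := by
        refine Real.exp_le_exp.2 (mul_le_mul_of_nonneg_left ?_ ht)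
        refine (harmonic_le_one_add_log N).trans ?_
        rcases N.eq_zero_or_pos with rfl | hN
        · simp
        · have : (0 : ℝ) < N := by exact_mod_cast hN
          gcongr
          linarith
    _ = Real.exp t * ((N : ℝ) + 1) ^ t := by
        rw [Real.rpow_def_of_pos (by positivity), ← Real.exp_add]
        congr 1
        ring

theorem pow_succ_sub_pow_succ_le {a b : ℝ} (hb : 0 ≤ b) (hab : b ≤ a) (k : ℕ) :
    a ^ (k + 1) - b ^ (k + 1) ≤ (k + 1) * a ^ k * (a - b) := by
  induction k with
  | zero => simp
  | succ k ih =>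
    have h1 : b ^ (k + 1) ≤ a ^ (k + 1) := pow_le_pow_left₀ hb hab _
    have h2 := mul_le_mul_of_nonneg_left ih (hb.trans hab)
    have h3 := mul_le_mul_of_nonneg_right h1 (sub_nonneg.2 hab)
    push_cast
    calc a ^ (k + 1 + 1) - b ^ (k + 1 + 1)
        = a * (a ^ (k + 1) - b ^ (k + 1)) + b ^ (k + 1) * (a - b) := by ring
      _ ≤ a * ((k + 1) * a ^ k * (a - b)) + a ^ (k + 1) * (a - b) := add_le_add h2 h3
      _ = _ := by ring

/-- Discrete form of the iterated integral of `1/y`, which is `(log y)^k / k!`. Each of the `k`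
summations loses a shift in the logarithm, and these losses add up to at most `H_k`. -/
theorem pow_div_factorial_le (k N : ℕ) :
    (max (Real.log ((N : ℝ) + 2) - harmonic k) 0) ^ k / k.factorial ≤ recipEsymm k N := by
  induction k generalizing N with
  | zero => simp
  | succ k ih =>
    -- The shift `H_k` is kept fixed while summing over `N`: the increment of the left side is at
    -- most `e_k(N)/(N + 1)`, by `a^(k+1) - b^(k+1) ≤ (k+1) a^k (a - b)` and `log(N+2) - log(N+1) ≤
    -- 1/(N+1)`.
    have key : ∀ N : ℕ, (max (Real.log ((N : ℝ) + 1) - harmonic k) 0) ^ (k + 1)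
        / (k + 1).factorial ≤ recipEsymm (k + 1) N := by
      intro N
      induction N with
      | zero =>
        have : (0 : ℝ) ≤ harmonic k := by
          rw [harmonic, Rat.cast_sum]
          exact Finset.sum_nonneg fun i _ => by push_cast; positivity
        simp [this]
      | succ N ihN =>
        rw [succ_succ]
        set c : ℝ := (harmonic k : ℝ)
        have hN2 : ((N + 1 : ℕ) : ℝ) + 1 = (N : ℝ) + 2 := by push_cast; ring
        rw [hN2]
        set a := max (Real.log ((N : ℝ) + 2) - c) 0
        set b := max (Real.log ((N : ℝ) + 1) - c) 0
        have hlog : Real.log ((N : ℝ) + 2) - Real.log ((N : ℝ) + 1) ≤ 1 / ((N : ℝ) + 1) := by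
          rw [← Real.log_div (by positivity) (by positivity)]
          refine (Real.log_le_sub_one_of_pos (by positivity)).trans (le_of_eq ?_)
          field_simp
          ring
        have hlog' : Real.log ((N : ℝ) + 1) ≤ Real.log ((N : ℝ) + 2) :=
          Real.log_le_log (by positivity) (by linarith)
        have hab : b ≤ a := max_le_max_right _ (by linarith)
        have hsub : a - b ≤ 1 / ((N : ℝ) + 1) := by
          have : (0 : ℝ) < 1 / ((N : ℝ) + 1) := by positivity
          rw [sub_le_iff_le_add]
          refine max_le ?_ ?_
          · have := le_max_left (Real.log ((N : ℝ) + 1) - c) 0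
            change _ ≤ _ + b
            linarith
          · have := le_max_right (Real.log ((N : ℝ) + 1) - c) 0
            positivity
        have ha : 0 ≤ a := le_max_right _ _
        have h1 := pow_succ_sub_pow_succ_le (le_max_right _ _ : 0 ≤ b) hab k
        have h2 : ((k : ℝ) + 1) * a ^ k * (a - b) ≤ ((k : ℝ) + 1) * a ^ k * (1 / ((N : ℝ) + 1)) :=
          mul_le_mul_of_nonneg_left hsub (by positivity)
        have h3 : a ^ k / k.factorial / ((N : ℝ) + 1) ≤ recipEsymm k N / ((N : ℝ) + 1) := by
          gcongr
          exact ih N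
        have h4 : a ^ k / k.factorial / ((N : ℝ) + 1) =
            ((k : ℝ) + 1) * a ^ k * (1 / ((N : ℝ) + 1)) / (k + 1).factorial := by
          rw [Nat.factorial_succ]
          push_cast
          field_simp
        have h5 : (a ^ (k + 1) - b ^ (k + 1)) / (k + 1).factorial ≤
            ((k : ℝ) + 1) * a ^ k * (1 / ((N : ℝ) + 1)) / (k + 1).factorial := by
          gcongr
          exact h1.trans h2
        rw [sub_div] at h5
        linarith
    refine le_trans ?_ (key N)
    refine div_le_div_of_nonneg_right ?_ (Nat.cast_nonneg _)
    refine pow_le_pow_left₀ (le_max_right _ _) (max_le ?_ (le_max_right _ _)) _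
    rw [harmonic_succ]
    push_cast
    -- If `k ≤ N`, replacing `log(N+1)` by `log(N+2)` costs at most `1/(N+1) ≤ 1/(k+1)`, which the
    -- new harmonic term pays for. If `N < k`, then `log(N+2) ≤ log(k+1) ≤ H_k` and the positive
    -- part is zero.
    rcases le_or_gt k N with hkN | hkN
    · refine le_max_of_le_left ?_
      have hlog : Real.log ((N : ℝ) + 2) - Real.log ((N : ℝ) + 1) ≤ 1 / ((N : ℝ) + 1) := by
        rw [← Real.log_div (by positivity) (by positivity)]
        refine (Real.log_le_sub_one_of_pos (by positivity)).trans (le_of_eq ?_)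
        field_simp
        ring
      have : 1 / ((N : ℝ) + 1) ≤ ((k : ℝ) + 1)⁻¹ := by
        rw [one_div]
        gcongr
      linarith
    · refine le_max_of_le_right ?_
      have h1 := log_add_one_le_harmonic k
      have h2 : Real.log ((N : ℝ) + 2) ≤ Real.log ((k + 1 : ℕ) : ℝ) := by
        refine Real.log_le_log (by positivity) ?_
        have : ((N + 2 : ℕ) : ℝ) ≤ ((k + 1 : ℕ) : ℝ) := by exact_mod_cast Nat.succ_le_succ hkN
        exact_mod_cast this
      have h3 : (0 : ℝ) ≤ ((k : ℝ) + 1)⁻¹ := by positivity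
      push_cast at *
      linarith

end recipEsymm

/-! ### Exact laws, Chernoff tail bounds and window probabilities -/

namespace IsCProcess

variable {Ω : Type*} [MeasurableSpace Ω] {μ : Measure Ω} [IsProbabilityMeasure μ]
  {C : ℕ → Ω → ℕ}

theorem measureReal_succ_zero (hC : IsCProcess μ C) (n : ℕ) :
    μ.real {ω | C (n + 1) ω = 0} = 0 := by
  rw [hC.measureReal_succ]; simp

theorem measureReal_succ_one (hC : IsCProcess μ C) (n : ℕ) :
    μ.real {ω | C (n + 1) ω = 1} = 0 := by
  rw [hC.measureReal_succ]; simp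

theorem measureReal_eq_recipEsymm (hC : IsCProcess μ C) (k N : ℕ) :
    μ.real {ω | C (k + 1) ω = N + 2} = recipEsymm k N / ((N + 2) * (N + 1)) := by
  have hN : ((N + 2 : ℕ) : ℝ) - 1 = N + 1 := by push_cast; ring
  induction k generalizing N with
  | zero =>
    rw [hC.measureReal_succ, Finset.sum_eq_single 1]
    · rw [hC.measureReal_zero, hN]
      simp
    · intro i _ hi
      rw [hC.measureReal_zero, if_neg hi, zero_mul]
    · simp
  | succ k ih =>
    rw [hC.measureReal_succ, Finset.sum_range_succ', Finset.sum_range_succ',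
      hC.measureReal_succ_one, recipEsymm.succ_eq_sum, Finset.sum_div, hN]
    simp only [Nat.cast_zero, zero_div, mul_zero, zero_mul, add_zero]
    refine Finset.sum_congr rfl fun M _ => ?_
    rw [ih M (by push_cast; ring)]
    push_cast
    field_simp
    ring

/-- The chain increases, so this is the probability of first reaching level `N + 2` at step `n + 1`.
Summed over `n`, it turns tail probabilities into sums of `recipEsymm`. -/
theorem measureReal_lt_sub (hC : IsCProcess μ C) (n N : ℕ) :
    μ.real {ω | C n ω < N + 2} - μ.real {ω | C (n + 1) ω < N + 2} =
      recipEsymm n N / (N + 1) := by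
  simp only [hC.measureReal_lt]
  induction N with
  | zero =>
    cases n <;> simp [Finset.sum_range_succ, hC.measureReal_zero, hC.measureReal_succ_zero,
      hC.measureReal_succ_one]
  | succ N ih =>
    rw [show N + 1 + 2 = (N + 2) + 1 from rfl, Finset.sum_range_succ _ (N + 2),
      Finset.sum_range_succ _ (N + 2),
      hC.measureReal_eq_recipEsymm, add_sub_add_comm, ih]
    cases n with
    | zero =>
      rw [hC.measureReal_zero, if_neg (by omega)]
      simp only [recipEsymm.zero_left]
      push_cast
      field_simp
      ring
    | succ n =>
      rw [hC.measureReal_eq_recipEsymm, recipEsymm.succ_succ]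
      push_cast
      field_simp
      ring

/-- Level `N + 2` must be crossed at one of the steps `1, …, n`, so the tail is a sum of `recipEsymm
k N / (N + 1)` over `k < n`. There `t ^ (k - n) ≥ 1` because `t ≤ 1`, and the generating function
takes over. -/
theorem measureReal_ge_le (hC : IsCProcess μ C) {t : ℝ} (ht : 0 < t) (ht1 : t ≤ 1) (n N : ℕ) :
    μ.real {ω | N + 2 ≤ C n ω} ≤ (t ^ n)⁻¹ * (Real.exp t * ((N : ℝ) + 1) ^ (t - 1)) := by
  have h0 : μ.real {ω | C 0 ω < N + 2} = 1 := by
    rw [hC.measureReal_lt, Finset.sum_eq_single 1]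
    · simp [hC.measureReal_zero]
    · intro i _ hi
      rw [hC.measureReal_zero, if_neg hi]
    · simp
  have h1 : μ.real {ω | C n ω < N + 2} =
      1 - ∑ k ∈ Finset.range n, recipEsymm k N / (N + 1) := by
    have := Finset.sum_range_sub' (fun n => μ.real {ω | C n ω < N + 2}) n
    simp only [hC.measureReal_lt_sub, h0] at this
    linarith
  have h2 : μ.real {ω | N + 2 ≤ C n ω} = ∑ k ∈ Finset.range n, recipEsymm k N / (N + 1) := by
    have h3 : {ω | N + 2 ≤ C n ω} = {ω | C n ω < N + 2}ᶜ := by ext; simp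
    rw [h3, probReal_compl_eq_one_sub, h1]
    · ring
    · exact hC.isMarkovChain.measurable n (measurableSet_Iio (a := N + 2))
  rw [h2, Real.rpow_sub_one (by positivity), ← mul_div_assoc, ← mul_div_assoc, ← Finset.sum_div]
  gcongr
  refine le_trans ?_ (mul_le_mul_of_nonneg_left
    (recipEsymm.sum_mul_pow_le ht.le N (Finset.range n)) (by positivity))
  rw [Finset.mul_sum]
  refine Finset.sum_le_sum fun k hk => ?_
  have h3 : 1 ≤ (t ^ n)⁻¹ * t ^ k := by
    rw [← div_eq_inv_mul, one_le_div (by positivity)]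
    exact pow_le_pow_of_le_one ht.le ht1 (Finset.mem_range.1 hk).le
  calc recipEsymm k N ≤ ((t ^ n)⁻¹ * t ^ k) * recipEsymm k N :=
        le_mul_of_one_le_left (recipEsymm.nonneg k N) h3
    _ = _ := by ring

/-- The complementary sum runs over `k ≥ n`, where `t ^ (k - n) ≥ 1` because `t ≥ 1`. -/
theorem measureReal_lt_le (hC : IsCProcess μ C) {t : ℝ} (ht : 1 ≤ t) (n N : ℕ) :
    μ.real {ω | C n ω < N + 2} ≤ (t ^ n)⁻¹ * (Real.exp t * ((N : ℝ) + 1) ^ (t - 1)) := by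
  have ht0 : 0 < t := zero_lt_one.trans_le ht
  -- The chain starts at `1` and gains at least `1` per step, so after `N + 1` steps it is at least
  -- `N + 2`; this makes the telescoping sum finite.
  have h0 : μ.real {ω | C (n + (N + 1)) ω < N + 2} = 0 := by
    rw [hC.measureReal_lt, ← add_assoc, Finset.sum_range_succ', Finset.sum_range_succ',
      hC.measureReal_succ_zero, hC.measureReal_succ_one, add_zero, add_zero]
    refine Finset.sum_eq_zero fun M hM => ?_
    rw [hC.measureReal_eq_recipEsymm, recipEsymm.eq_zero_of_lt, zero_div]
    have := Finset.mem_range.1 hM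
    omega
  have h1 : μ.real {ω | C n ω < N + 2} =
      ∑ k ∈ Finset.range (N + 1), recipEsymm (n + k) N / (N + 1) := by
    have := Finset.sum_range_sub' (fun k => μ.real {ω | C (n + k) ω < N + 2}) (N + 1)
    simp only [← add_assoc, hC.measureReal_lt_sub] at this
    simp only [add_assoc, h0] at this
    rw [this]
    simp
  rw [h1, Real.rpow_sub_one (by positivity), ← mul_div_assoc, ← mul_div_assoc, ← Finset.sum_div]
  gcongr
  have h2 := recipEsymm.sum_mul_pow_le ht0.le N
    ((Finset.range (N + 1)).map (addLeftEmbedding n))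
  rw [Finset.sum_map] at h2
  refine le_trans ?_ (mul_le_mul_of_nonneg_left h2 (by positivity))
  rw [Finset.mul_sum]
  refine Finset.sum_le_sum fun k _ => ?_
  simp only [addLeftEmbedding_apply]
  have h3 : 1 ≤ (t ^ n)⁻¹ * t ^ (n + k) := by
    rw [← div_eq_inv_mul, one_le_div (by positivity)]
    exact pow_le_pow_right₀ ht (Nat.le_add_right n k)
  calc recipEsymm (n + k) N ≤ ((t ^ n)⁻¹ * t ^ (n + k)) * recipEsymm (n + k) N :=
        le_mul_of_one_le_left (recipEsymm.nonneg _ N) h3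
    _ = _ := by ring

theorem recipEsymm_div_le_measureReal (hC : IsCProcess μ C) (k N : ℕ) :
    recipEsymm k N / (2 * (N + 2)) ≤
      μ.real {ω | N + 2 ≤ C (k + 1) ω ∧ C (k + 1) ω < 2 * (N + 2)} := by
  -- Monotonicity in the second argument freezes `recipEsymm` at `N`; the weights `1/((j+2)(j+1))`
  -- then telescope.
  have h1 : ∀ m : ℕ, recipEsymm k N * (1 / ((N : ℝ) + 1) - 1 / (N + 1 + m)) ≤
      ∑ i ∈ Finset.range m, μ.real {ω | C (k + 1) ω = N + i + 2} := by
    intro m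
    induction m with
    | zero => simp
    | succ m ih =>
      rw [Finset.sum_range_succ, hC.measureReal_eq_recipEsymm]
      have h2 : recipEsymm k N / (((N + m : ℕ) + 2) * ((N + m : ℕ) + 1)) ≤
          recipEsymm k (N + m) / (((N + m : ℕ) + 2) * ((N + m : ℕ) + 1)) := by
        gcongr
        exact recipEsymm.monotone k (Nat.le_add_right N m)
      refine le_trans (le_of_eq ?_) (add_le_add ih h2)
      push_cast
      field_simp
      ring
  have h2 : μ.real {ω | N + 2 ≤ C (k + 1) ω ∧ C (k + 1) ω < 2 * (N + 2)} =
      ∑ i ∈ Finset.range (N + 2), μ.real {ω | C (k + 1) ω = N + i + 2} := by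
    rw [← measureReal_biUnion_finset]
    · congr 1
      ext ω
      simp only [Set.mem_ofPred_eq, Finset.mem_range, Set.mem_iUnion, exists_prop]
      constructor
      · intro h
        exact ⟨C (k + 1) ω - (N + 2), by omega, by omega⟩
      · rintro ⟨i, hi, h⟩
        omega
    · intro s _ t _ hst
      refine Set.disjoint_left.2 ?_
      intro ω h1 h2
      simp only [Set.mem_ofPred_eq] at h1 h2
      omega
    · exact fun i _ => hC.measurableSet_eq _ _
  rw [h2]
  refine le_trans ?_ (h1 (N + 2))
  rw [div_eq_mul_one_div]
  refine mul_le_mul_of_nonneg_left ?_ (recipEsymm.nonneg k N)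
  push_cast
  rw [div_sub_div _ _ (by positivity) (by positivity), div_le_div_iff₀ (by positivity) (by positivity)]
  have : (0 : ℝ) ≤ N := Nat.cast_nonneg N
  nlinarith [mul_nonneg this this]

end IsCProcess

/-! ### The rate function -/

theorem rateC_of_neg_one_lt {x : ℝ} (hx : -1 < x) :
    rateC x = ((x - Real.log (x + 1) : ℝ) : EReal) := if_pos hx

theorem rateC_of_le_neg_one {x : ℝ} (hx : x ≤ -1) : rateC x = ⊤ := if_neg (not_lt.2 hx)

namespace RateC

theorem lt_of_lt_of_nonneg {x y : ℝ} (hx : 0 ≤ x) (hxy : x < y) :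
    x - Real.log (x + 1) < y - Real.log (y + 1) := by
  have hx1 : 0 < x + 1 := by linarith
  have hy1 : 0 < y + 1 := by linarith
  have h1 : Real.log ((y + 1) / (x + 1)) < (y + 1) / (x + 1) - 1 :=
    Real.log_lt_sub_one_of_pos (by positivity) (by
      rw [Ne, div_eq_one_iff_eq hx1.ne']
      linarith)
  rw [Real.log_div hy1.ne' hx1.ne'] at h1
  have h2 : (y + 1) / (x + 1) - 1 ≤ y - x := by
    rw [div_sub_one hx1.ne', div_le_iff₀ hx1]
    nlinarith [mul_nonneg hx (sub_nonneg.2 hxy.le)]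
  linarith

theorem lt_of_lt_of_nonpos {x y : ℝ} (hx : -1 < x) (hxy : x < y) (hy : y ≤ 0) :
    y - Real.log (y + 1) < x - Real.log (x + 1) := by
  have hx1 : 0 < x + 1 := by linarith
  have hy1 : 0 < y + 1 := by linarith
  have h1 : Real.log ((x + 1) / (y + 1)) < (x + 1) / (y + 1) - 1 :=
    Real.log_lt_sub_one_of_pos (by positivity) (by
      rw [Ne, div_eq_one_iff_eq hy1.ne']
      linarith)
  rw [Real.log_div hx1.ne' hy1.ne'] at h1
  have h2 : (x + 1) / (y + 1) - 1 ≤ x - y := by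
    rw [div_sub_one hy1.ne', div_le_iff₀ hy1]
    nlinarith [mul_nonneg (neg_nonneg.2 hy) (sub_nonneg.2 hxy.le)]
  linarith

theorem continuousOn_real : ContinuousOn (fun x : ℝ => x - Real.log (x + 1)) (Set.Ioi (-1)) :=
  continuousOn_id.sub (ContinuousOn.log (by fun_prop) fun x hx => by
    have : -1 < x := hx
    linarith)

theorem mem_Icc_of_le {a x : ℝ} (hx : -1 < x) (h : x - Real.log (x + 1) ≤ a) :
    x ∈ Set.Icc (-1 + Real.exp (-a - 1)) (2 * a + 1) := by
  have hx1 : 0 < x + 1 := by linarith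
  constructor
  · have : Real.exp (-a - 1) ≤ x + 1 := by
      rw [← Real.le_log_iff_exp_le hx1]
      linarith
    linarith
  -- The tangent to `log` at `2` rather than at `1` has slope `1/2`, so `x - log (x + 1)` grows at
  -- least like `x/2`.
  · have h1 := Real.log_le_sub_one_of_pos (half_pos hx1)
    rw [Real.log_div hx1.ne' two_ne_zero] at h1
    have h2 := Real.log_le_sub_one_of_pos (zero_lt_two (α := ℝ))
    linarith

theorem isCompact_levelSet (a : ℝ) : IsCompact {x | rateC x ≤ (a : EReal)} := by
  have hsub : Set.Icc (-1 + Real.exp (-a - 1)) (2 * a + 1) ⊆ Set.Ioi (-1) := fun x hx =>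
    (lt_add_of_pos_right (-1) (Real.exp_pos _)).trans_le hx.1
  have heq : {x | rateC x ≤ (a : EReal)} = Set.Icc (-1 + Real.exp (-a - 1)) (2 * a + 1) ∩
      (fun x : ℝ => x - Real.log (x + 1)) ⁻¹' Set.Iic a := by
    ext x
    constructor
    · intro hx
      have hx' : rateC x ≤ (a : EReal) := hx
      rcases lt_or_ge (-1) x with h | h
      · rw [rateC_of_neg_one_lt h, EReal.coe_le_coe_iff] at hx'
        exact ⟨mem_Icc_of_le h hx', hx'⟩
      · rw [rateC_of_le_neg_one h] at hx'
        exact absurd hx' (not_le.2 (EReal.coe_lt_top a))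
    · rintro ⟨h1, h2⟩
      change rateC x ≤ (a : EReal)
      rw [rateC_of_neg_one_lt (hsub h1), EReal.coe_le_coe_iff]
      exact h2
  rw [heq]
  exact isCompact_Icc.of_isClosed_subset
    ((continuousOn_real.mono hsub).preimage_isClosed_of_isClosed isClosed_Icc isClosed_Iic)
    Set.inter_subset_left

theorem nonneg (x : ℝ) : 0 ≤ rateC x := by
  rcases lt_or_ge (-1) x with h | h
  · rw [rateC_of_neg_one_lt h, EReal.coe_nonneg]
    have := Real.log_le_sub_one_of_pos (show 0 < x + 1 by linarith)
    linarith
  · rw [rateC_of_le_neg_one h]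
    exact le_top

theorem isGoodRateFunction : IsGoodRateFunction rateC where
  nonneg := nonneg
  lowerSemicontinuous := by
    rw [lowerSemicontinuous_iff_isClosed_preimage]
    intro y
    induction y with
    | bot =>
      convert isClosed_empty
      ext x
      simp only [Set.mem_preimage, Set.mem_Iic, Set.mem_empty_iff_false, iff_false, not_le]
      exact EReal.bot_lt_zero.trans_le (nonneg x)
    | coe a => exact (isCompact_levelSet a).isClosed
    | top => simp
  isCompact_levelSet := isCompact_levelSet

theorem exists_pos_eq {a : ℝ} (ha : 0 < a) : ∃ x, 0 < x ∧ x - Real.log (x + 1) = a := by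
  have h0 : ContinuousOn (fun x : ℝ => x - Real.log (x + 1)) (Set.Icc 0 (2 * a + 2)) :=
    continuousOn_real.mono fun x hx => (neg_one_lt_zero (R := ℝ)).trans_le hx.1
  have h1 : a ≤ (2 * a + 2) - Real.log (2 * a + 2 + 1) := by
    by_contra! h
    have := (mem_Icc_of_le (by linarith) h.le).2
    linarith
  obtain ⟨x, hx, hxa⟩ := intermediate_value_Icc (by linarith) h0
    (show a ∈ Set.Icc _ _ from ⟨by simpa using ha.le, h1⟩)
  refine ⟨x, hx.1.lt_of_ne ?_, hxa⟩
  rintro rfl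
  simp at hxa
  linarith

theorem exists_neg_eq {a : ℝ} (ha : 0 < a) :
    ∃ x, -1 < x ∧ x < 0 ∧ x - Real.log (x + 1) = a := by
  have he : Real.exp (-a - 1) < 1 := by
    have := Real.exp_lt_exp.2 (show -a - 1 < 0 by linarith)
    rwa [Real.exp_zero] at this
  have hlo : -1 < -1 + Real.exp (-a - 1) := lt_add_of_pos_right (-1) (Real.exp_pos _)
  have h0 : ContinuousOn (fun x : ℝ => x - Real.log (x + 1))
      (Set.Icc (-1 + Real.exp (-a - 1)) 0) :=
    continuousOn_real.mono fun x hx => hlo.trans_le hx.1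
  have h1 : a ≤ (-1 + Real.exp (-a - 1)) - Real.log (-1 + Real.exp (-a - 1) + 1) := by
    rw [neg_add_cancel_comm, Real.log_exp]
    linarith [Real.exp_pos (-a - 1)]
  obtain ⟨x, hx, hxa⟩ := intermediate_value_Icc' (by linarith) h0
    (show a ∈ Set.Icc _ _ from ⟨by simpa using ha.le, h1⟩)
  refine ⟨x, hlo.trans_le hx.1, hx.2.lt_of_ne ?_, hxa⟩
  rintro rfl
  simp at hxa
  linarith

end RateC

/-! ### Exponential bounds turned into bounds on normalized logarithms -/

section LogarithmicAsymptotics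

variable {Ω : Type*} [MeasurableSpace Ω] {μ : Measure Ω} [IsProbabilityMeasure μ]

theorem ENNReal.log_ofReal_exp_div (r : ℝ) (n : ℕ) :
    ENNReal.log (ENNReal.ofReal (Real.exp r)) / (n : EReal) = ((r / n : ℝ) : EReal) := by
  rw [ENNReal.log_ofReal, if_neg (not_le.2 (Real.exp_pos r)), Real.log_exp, EReal.coe_div,
    EReal.coe_natCast]

theorem limsup_log_measure_div_le {E : ℕ → Set Ω} {r : ℕ → ℝ} {b : ℝ}
    (hr : Tendsto (fun n : ℕ => r n / n) atTop (𝓝 b))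
    (hE : ∀ᶠ n in atTop, μ.real (E n) ≤ Real.exp (r n)) :
    limsup (fun n : ℕ => ENNReal.log (μ (E n)) / (n : EReal)) atTop ≤ (b : EReal) := by
  have hr' : Tendsto (fun n : ℕ => ((r n / n : ℝ) : EReal)) atTop (𝓝 (b : EReal)) :=
    (continuous_coe_real_ereal.tendsto b).comp hr
  rw [← hr'.limsup_eq]
  refine limsup_le_limsup ?_
  filter_upwards [hE] with n hn
  rw [← ENNReal.log_ofReal_exp_div, ← ofReal_measureReal (μ := μ) (s := E n)]
  exact EReal.div_le_div_right_of_nonneg (by positivity)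
    (ENNReal.log_monotone (ENNReal.ofReal_le_ofReal hn))

theorem le_liminf_log_measure_div {E : ℕ → Set Ω} {r : ℕ → ℝ} {b : ℝ}
    (hr : Tendsto (fun n : ℕ => r n / n) atTop (𝓝 b))
    (hE : ∀ᶠ n in atTop, Real.exp (r n) ≤ μ.real (E n)) :
    (b : EReal) ≤ liminf (fun n : ℕ => ENNReal.log (μ (E n)) / (n : EReal)) atTop := by
  have hr' : Tendsto (fun n : ℕ => ((r n / n : ℝ) : EReal)) atTop (𝓝 (b : EReal)) :=
    (continuous_coe_real_ereal.tendsto b).comp hr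
  rw [← hr'.liminf_eq]
  refine liminf_le_liminf ?_
  filter_upwards [hE] with n hn
  rw [← ENNReal.log_ofReal_exp_div, ← ofReal_measureReal (μ := μ) (s := E n)]
  exact EReal.div_le_div_right_of_nonneg (by positivity)
    (ENNReal.log_monotone (ENNReal.ofReal_le_ofReal hn))

end LogarithmicAsymptotics

theorem tendsto_log_natCast_div_atTop :
    Tendsto (fun n : ℕ => Real.log n / n) atTop (𝓝 0) :=
  Real.isLittleO_log_id_atTop.tendsto_div_nhds_zero.comp tendsto_natCast_atTop_atTop

/-- Stirling's upper bound up to a polynomial factor. The induction step is `e ≤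
((k+2)/(k+1))^(k+2)`, which follows from `log y ≥ 1 - 1/y`. -/
theorem Nat.factorial_mul_exp_le (k : ℕ) :
    (k.factorial : ℝ) * Real.exp k ≤ ((k : ℝ) + 1) ^ (k + 1) := by
  induction k with
  | zero => simp
  | succ k ih =>
    have h1 : Real.exp 1 ≤ (((k : ℝ) + 2) / (k + 1)) ^ (k + 2) := by
      rw [← Real.le_log_iff_exp_le (by positivity), Real.log_pow]
      have h2 := Real.one_sub_inv_le_log_of_pos (show 0 < ((k : ℝ) + 2) / (k + 1) by positivity)
      have h3 : ((k + 2 : ℕ) : ℝ) * (1 - (((k : ℝ) + 2) / (k + 1))⁻¹) = 1 := by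
        push_cast
        field_simp
        ring
      calc (1 : ℝ) = ((k + 2 : ℕ) : ℝ) * (1 - (((k : ℝ) + 2) / (k + 1))⁻¹) := h3.symm
        _ ≤ _ := by gcongr
    rw [Nat.factorial_succ]
    push_cast
    calc ((k : ℝ) + 1) * k.factorial * Real.exp (k + 1)
        = (k + 1) * (k.factorial * Real.exp k) * Real.exp 1 := by rw [Real.exp_add]; ring
      _ ≤ (k + 1) * (k + 1) ^ (k + 1) * (((k : ℝ) + 2) / (k + 1)) ^ (k + 2) := by gcongr
      _ = (k + 1 + 1) ^ (k + 1 + 1) := by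
        rw [div_pow]
        field_simp
        ring

/-! ### Large deviation upper and lower bounds -/

namespace IsCProcess

variable {Ω : Type*} [MeasurableSpace Ω] {μ : Measure Ω} [IsProbabilityMeasure μ]
  {C : ℕ → Ω → ℕ}

/-- Value of the Chernoff bound `t^(-n) R^(t-1)` for `R = e^{n(x+1)}` at its minimizer `t =
1/(x+1)`. -/
theorem inv_pow_mul_exp_rpow_eq {x : ℝ} (hx : -1 < x) (n : ℕ) :
    (((x + 1)⁻¹ ^ n)⁻¹) * (Real.exp (n * (x + 1)) ^ ((x + 1)⁻¹ - 1)) =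
      Real.exp (-(n * (x - Real.log (x + 1)))) := by
  have hx1 : 0 < x + 1 := by linarith
  rw [inv_pow, inv_inv, ← Real.exp_mul]
  nth_rw 1 [← Real.exp_log hx1]
  rw [← Real.exp_nat_mul, ← Real.exp_add]
  congr 1
  field_simp
  ring

theorem measureReal_ge_exp_le (hC : IsCProcess μ C) {x : ℝ} (hx : 0 < x) {n : ℕ} (hn : n ≠ 0) :
    μ.real {ω | x ≤ (Real.log (C n ω : ℝ) - (n : ℝ)) / (n : ℝ)} ≤
      2 * Real.exp (x + 1)⁻¹ * Real.exp (-(n * (x - Real.log (x + 1)))) := by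
  have hn0 : (0 : ℝ) < n := by exact_mod_cast Nat.pos_of_ne_zero hn
  set t := (x + 1)⁻¹ with ht
  have ht0 : 0 < t := by positivity
  have ht1 : t ≤ 1 := inv_le_one_of_one_le₀ (by linarith)
  set R := Real.exp (n * (x + 1)) with hR
  have hR1 : 1 < R := Real.one_lt_exp_iff.2 (by positivity)
  obtain ⟨N, hN⟩ : ∃ N, ⌈R⌉₊ = N + 2 := by
    have : 1 < ⌈R⌉₊ := Nat.lt_ceil.2 (by simpa using hR1)
    exact ⟨⌈R⌉₊ - 2, by omega⟩
  have hRN : R ≤ N + 2 := by exact_mod_cast hN ▸ Nat.le_ceil R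
  have hsub : {ω | x ≤ (Real.log (C n ω : ℝ) - (n : ℝ)) / (n : ℝ)} ⊆ {ω | N + 2 ≤ C n ω} := by
    intro ω hω
    have h1 : x ≤ (Real.log (C n ω : ℝ) - (n : ℝ)) / (n : ℝ) := hω
    rw [le_div_iff₀ hn0] at h1
    have h2 : n * (x + 1) ≤ Real.log (C n ω) := by linarith
    -- State `0` is excluded although `Real.log 0 = 0`, because `n * (x + 1)` is positive.
    have h3 : (0 : ℝ) < C n ω := by
      rcases (C n ω).eq_zero_or_pos with h | h
      · rw [h] at h2
        simp only [Nat.cast_zero, Real.log_zero] at h2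
        have : 0 < n * (x + 1) := by positivity
        linarith
      · exact_mod_cast h
    change N + 2 ≤ C n ω
    rw [← hN]
    exact Nat.ceil_le.2 ((Real.le_log_iff_exp_le h3).1 h2)
  refine (measureReal_mono hsub).trans ((hC.measureReal_ge_le ht0 ht1 n N).trans ?_)
  rw [← inv_pow_mul_exp_rpow_eq (by linarith) n, ← ht, ← hR]
  -- The exponent is nonpositive, so a lower bound on `N + 1` is needed: `2(N + 1) ≥ N + 2 ≥ R`.
  -- This costs `2^(1-t) ≤ 2`.
  have h4 : ((N : ℝ) + 1) ^ (t - 1) ≤ 2 * R ^ (t - 1) := by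
    calc ((N : ℝ) + 1) ^ (t - 1) ≤ (2⁻¹ * R) ^ (t - 1) :=
          Real.rpow_le_rpow_of_nonpos (by positivity)
            (by have : (0 : ℝ) ≤ N := Nat.cast_nonneg N; linarith) (by linarith)
      _ = 2 ^ (1 - t) * R ^ (t - 1) := by
          rw [Real.mul_rpow (by norm_num) (by positivity), Real.inv_rpow (by norm_num),
            ← Real.rpow_neg (by norm_num), neg_sub]
      _ ≤ 2 * R ^ (t - 1) := by
          gcongr
          calc (2 : ℝ) ^ (1 - t) ≤ 2 ^ (1 : ℝ) :=
                Real.rpow_le_rpow_of_exponent_le (by norm_num) (by linarith)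
            _ = 2 := Real.rpow_one 2
  calc (t ^ n)⁻¹ * (Real.exp t * ((N : ℝ) + 1) ^ (t - 1))
      ≤ (t ^ n)⁻¹ * (Real.exp t * (2 * R ^ (t - 1))) := by gcongr
    _ = _ := by ring

theorem measureReal_le_exp_le (hC : IsCProcess μ C) {x : ℝ} (hx : -1 < x) (hx0 : x ≤ 0)
    {n : ℕ} (hn : n ≠ 0) :
    μ.real {ω | (Real.log (C n ω : ℝ) - (n : ℝ)) / (n : ℝ) ≤ x} ≤
      Real.exp (x + 1)⁻¹ * Real.exp (-(n * (x - Real.log (x + 1)))) := by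
  have hn0 : (0 : ℝ) < n := by exact_mod_cast Nat.pos_of_ne_zero hn
  have hx1 : 0 < x + 1 := by linarith
  set t := (x + 1)⁻¹ with ht
  have ht1 : 1 ≤ t := (one_le_inv₀ hx1).2 (by linarith)
  set R := Real.exp (n * (x + 1)) with hR
  have hR1 : 1 ≤ R := Real.one_le_exp (by positivity)
  obtain ⟨N, hN⟩ : ∃ N, ⌊R⌋₊ = N + 1 := by
    have : 1 ≤ ⌊R⌋₊ := Nat.le_floor (by simpa using hR1)
    exact ⟨⌊R⌋₊ - 1, by omega⟩
  have hRN : (N : ℝ) + 1 ≤ R := by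
    have := Nat.floor_le (zero_le_one.trans hR1)
    rw [hN] at this
    exact_mod_cast this
  have hsub : {ω | (Real.log (C n ω : ℝ) - (n : ℝ)) / (n : ℝ) ≤ x} ⊆ {ω | C n ω < N + 2} := by
    intro ω hω
    have h1 : (Real.log (C n ω : ℝ) - (n : ℝ)) / (n : ℝ) ≤ x := hω
    rw [div_le_iff₀ hn0] at h1
    have h2 : Real.log (C n ω) ≤ n * (x + 1) := by linarith
    change C n ω < N + 2
    rcases (C n ω).eq_zero_or_pos with h | h
    · omega
    · have h3 : C n ω ≤ ⌊R⌋₊ :=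
        Nat.le_floor ((Real.log_le_iff_le_exp (by exact_mod_cast h)).1 h2)
      omega
  refine (measureReal_mono hsub).trans ((hC.measureReal_lt_le ht1 n N).trans ?_)
  rw [← inv_pow_mul_exp_rpow_eq hx n, ← ht, ← hR, mul_left_comm]
  have : ((N : ℝ) + 1) ^ (t - 1) ≤ R ^ (t - 1) :=
    Real.rpow_le_rpow (by positivity) hRN (by linarith)
  gcongr

theorem limsup_log_measure_le (hC : IsCProcess μ C) {Γ : Set ℝ} {a : ℝ}
    (ha : 0 < a) (hΓ : ∀ x ∈ Γ, (a : EReal) ≤ rateC x) :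
    limsup (fun n : ℕ => ENNReal.log
      (μ {ω | (Real.log (C n ω : ℝ) - (n : ℝ)) / (n : ℝ) ∈ Γ}) / (n : EReal)) atTop ≤
      ((-a : ℝ) : EReal) := by
  obtain ⟨y, hy0, hy⟩ := RateC.exists_pos_eq ha
  obtain ⟨z, hz1, hz0, hz⟩ := RateC.exists_neg_eq ha
  have hΓ' : ∀ x ∈ Γ, x ≤ z ∨ y ≤ x := by
    intro x hx
    by_contra! h
    -- The rate decreases on `(-1, 0]` and increases on `[0, ∞)`, so it is below `a` strictly
    -- between `z` and `y`.
    have h1 := hΓ x hx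
    rw [rateC_of_neg_one_lt (hz1.trans h.1), EReal.coe_le_coe_iff] at h1
    rcases le_total 0 x with h0 | h0
    · have := RateC.lt_of_lt_of_nonneg h0 h.2
      linarith
    · have := RateC.lt_of_lt_of_nonpos hz1 h.1 h0
      linarith
  set K := 2 * Real.exp (y + 1)⁻¹ + Real.exp (z + 1)⁻¹
  have hK : 0 < K := by positivity
  refine limsup_log_measure_div_le (r := fun n => Real.log K + -(n * a)) ?_ ?_
  · have h1 : Tendsto (fun n : ℕ => Real.log K / n + -a) atTop (𝓝 (0 + -a)) :=
      (tendsto_const_div_atTop_nhds_zero_nat _).add tendsto_const_nhds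
    rw [zero_add] at h1
    refine h1.congr' ?_
    filter_upwards [eventually_ne_atTop 0] with n hn
    field_simp
  · filter_upwards [eventually_ne_atTop 0] with n hn
    rw [Real.exp_add, Real.exp_log hK, add_mul, add_comm (_ * _)]
    have h1 := hC.measureReal_ge_exp_le hy0 hn
    have h2 := hC.measureReal_le_exp_le hz1 hz0.le hn
    rw [hy] at h1
    rw [hz] at h2
    refine le_trans ?_ ((measureReal_union_le _ _).trans (add_le_add h2 h1))
    exact measureReal_mono fun ω hω => hΓ' _ hω

/-- With `R = e^{nu}` and `N + 2 = ⌈R⌉ ≤ 2R`, the window `[N + 2, 2(N + 2))` lies in `[R, 4R]`,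
which accounts for both the `log 4` and the factor `4`. -/
theorem le_measureReal_Icc (hC : IsCProcess μ C) {u : ℝ} (hu : 0 < u) (k : ℕ) :
    (max (((k + 1 : ℕ) : ℝ) * u - harmonic k) 0) ^ k / k.factorial /
        (4 * Real.exp (((k + 1 : ℕ) : ℝ) * u)) ≤
      μ.real {ω | (Real.log (C (k + 1) ω : ℝ) - ((k + 1 : ℕ) : ℝ)) / ((k + 1 : ℕ) : ℝ) ∈
        Set.Icc (u - 1) (u - 1 + Real.log 4 / ((k + 1 : ℕ) : ℝ))} := by
  set n : ℝ := ((k + 1 : ℕ) : ℝ)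
  have hn0 : 0 < n := Nat.cast_pos.2 k.succ_pos
  set R := Real.exp (n * u) with hR
  have hR1 : 1 < R := Real.one_lt_exp_iff.2 (by positivity)
  have hR0 : 0 < R := zero_lt_one.trans hR1
  obtain ⟨N, hN⟩ : ∃ N, ⌈R⌉₊ = N + 2 := by
    have : 1 < ⌈R⌉₊ := Nat.lt_ceil.2 (by simpa using hR1)
    exact ⟨⌈R⌉₊ - 2, by omega⟩
  have hRN : R ≤ N + 2 := by exact_mod_cast hN ▸ Nat.le_ceil R
  have hNR : (N : ℝ) + 2 ≤ 2 * R := by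
    have := (Nat.ceil_lt_add_one hR0.le).le
    rw [hN] at this
    push_cast at this
    linarith
  have hsub : {ω | N + 2 ≤ C (k + 1) ω ∧ C (k + 1) ω < 2 * (N + 2)} ⊆
      {ω | (Real.log (C (k + 1) ω : ℝ) - n) / n ∈
        Set.Icc (u - 1) (u - 1 + Real.log 4 / n)} := by
    rintro ω ⟨h1, h2⟩
    have h1' : (N : ℝ) + 2 ≤ C (k + 1) ω := by exact_mod_cast h1
    have h2' : (C (k + 1) ω : ℝ) ≤ 2 * (N + 2) := by exact_mod_cast h2.le
    have hpos : (0 : ℝ) < C (k + 1) ω := hR0.trans_le (hRN.trans h1')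
    have h3 : n * u ≤ Real.log (C (k + 1) ω) :=
      (Real.le_log_iff_exp_le hpos).2 (hRN.trans h1')
    have h4 : Real.log (C (k + 1) ω) ≤ Real.log 4 + n * u := by
      rw [Real.log_le_iff_le_exp hpos, Real.exp_add, Real.exp_log (by norm_num)]
      linarith
    constructor
    · rw [le_div_iff₀ hn0]
      linarith
    · rw [div_le_iff₀ hn0, add_mul, div_mul_cancel₀ _ hn0.ne']
      linarith
  refine le_trans ?_ ((hC.recipEsymm_div_le_measureReal k N).trans (measureReal_mono hsub))
  have hmain := recipEsymm.pow_div_factorial_le k N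
  have hlog : n * u ≤ Real.log ((N : ℝ) + 2) := (Real.le_log_iff_exp_le (by positivity)).2 hRN
  have h5 : (max (n * u - harmonic k) 0) ^ k / k.factorial ≤ recipEsymm k N := by
    refine le_trans ?_ hmain
    refine div_le_div_of_nonneg_right ?_ (Nat.cast_nonneg _)
    exact pow_le_pow_left₀ (le_max_right _ _) (max_le_max_right _ (by linarith)) _
  refine div_le_div₀ (recipEsymm.nonneg k N) h5 (by positivity) (by linarith)

/-- The gap `u - v` absorbs the harmonic shift: `H_k ≤ 1 + log n` is eventually below `n (u - v)`,
so the base of the power is at least `n v`. -/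
theorem le_liminf_log_measure_of_lt (hC : IsCProcess μ C) {Γ : Set ℝ} {u v : ℝ} (hv : 0 < v)
    (hvu : v < u) (hΓ : Γ ∈ 𝓝 (u - 1)) :
    ((Real.log v + 1 - u : ℝ) : EReal) ≤ liminf (fun n : ℕ => ENNReal.log
      (μ {ω | (Real.log (C n ω : ℝ) - (n : ℝ)) / (n : ℝ) ∈ Γ}) / (n : EReal)) atTop := by
  refine le_liminf_log_measure_div
    -- This is the logarithm of `v^k e^k / (4 e^{nu} n)` with `k = n - 1`; the missing power gives
    -- the constant `log v + 1`, and the factorial bound gives the `log n`.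
    (r := fun n => n * (Real.log v + 1 - u) - (Real.log v + 1 + Real.log 4) - Real.log n) ?_ ?_
  · have h1 : Tendsto (fun n : ℕ => (Real.log v + 1 - u) - (Real.log v + 1 + Real.log 4) / n
        - Real.log n / n) atTop (𝓝 ((Real.log v + 1 - u) - 0 - 0)) :=
      (tendsto_const_nhds.sub (tendsto_const_div_atTop_nhds_zero_nat _)).sub
        tendsto_log_natCast_div_atTop
    rw [sub_zero, sub_zero] at h1
    refine h1.congr' ?_
    filter_upwards [eventually_ne_atTop 0] with n hn
    field_simp
  · obtain ⟨ε, hε, hball⟩ := Metric.mem_nhds_iff.1 hΓ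
    have h1 : ∀ᶠ n : ℕ in atTop, Real.log 4 / n < ε :=
      (tendsto_const_div_atTop_nhds_zero_nat _).eventually_lt_const hε
    have h2 : ∀ᶠ n : ℕ in atTop, 1 / (n : ℝ) + Real.log n / n < u - v := by
      have := (tendsto_const_div_atTop_nhds_zero_nat (1 : ℝ)).add tendsto_log_natCast_div_atTop
      rw [zero_add] at this
      exact this.eventually_lt_const (sub_pos.2 hvu)
    filter_upwards [eventually_ne_atTop 0, h1, h2] with n hn hn1 hn2
    obtain ⟨k, rfl⟩ := Nat.exists_eq_succ_of_ne_zero hn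
    rw [Nat.succ_eq_add_one] at *
    have hsub : {ω | (Real.log (C (k + 1) ω : ℝ) - ((k + 1 : ℕ) : ℝ)) / ((k + 1 : ℕ) : ℝ) ∈
        Set.Icc (u - 1) (u - 1 + Real.log 4 / ((k + 1 : ℕ) : ℝ))} ⊆
        {ω | (Real.log (C (k + 1) ω : ℝ) - ((k + 1 : ℕ) : ℝ)) / ((k + 1 : ℕ) : ℝ) ∈ Γ} := by
      intro ω hω
      refine hball ?_
      rw [Metric.mem_ball, Real.dist_eq, abs_lt]
      have := hω.1
      have := hω.2
      constructor <;> linarith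
    refine le_trans ?_ ((hC.le_measureReal_Icc (hv.trans hvu) k).trans (measureReal_mono hsub))
    have hfac := Nat.factorial_mul_exp_le k
    have hn0 : (0 : ℝ) < ((k + 1 : ℕ) : ℝ) := Nat.cast_pos.2 k.succ_pos
    have hharm : (harmonic k : ℝ) ≤ 1 + Real.log ((k + 1 : ℕ) : ℝ) := by
      refine le_trans ?_ (harmonic_le_one_add_log (k + 1))
      rw [harmonic_succ]
      push_cast
      have : (0 : ℝ) ≤ ((k : ℝ) + 1)⁻¹ := by positivity
      linarith
    have hcast : (k : ℝ) = ((k + 1 : ℕ) : ℝ) - 1 := by push_cast; ring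
    rw [show (k : ℝ) + 1 = ((k + 1 : ℕ) : ℝ) by push_cast; ring] at hfac
    rw [← add_div, div_lt_iff₀ hn0] at hn2
    set n : ℝ := ((k + 1 : ℕ) : ℝ)
    have hbase : n * v ≤ max (n * u - harmonic k) 0 := le_max_of_le_left (by linarith)
    have hexp : Real.exp (n * (Real.log v + 1 - u) - (Real.log v + 1 + Real.log 4) - Real.log n) =
        v ^ k * Real.exp k / (4 * Real.exp (n * u)) / n := by
      rw [Real.exp_sub, Real.exp_log hn0]
      congr 1
      have hvk : v ^ k = Real.exp (k * Real.log v) := by rw [Real.exp_nat_mul, Real.exp_log hv]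
      rw [hvk, ← Real.exp_add, ← Real.exp_log (show (0 : ℝ) < 4 by norm_num),
        ← Real.exp_add, ← Real.exp_sub, Real.log_exp, hcast]
      congr 1
      ring
    rw [hexp, div_right_comm]
    gcongr ?_ / _
    have hkey : Real.exp k / n ≤ n ^ k / k.factorial := by
      rw [div_le_div_iff₀ hn0 (by positivity), ← pow_succ, mul_comm]
      exact hfac
    calc v ^ k * Real.exp k / n = v ^ k * (Real.exp k / n) := by ring
      _ ≤ v ^ k * (n ^ k / k.factorial) := by gcongr
      _ = (n * v) ^ k / k.factorial := by rw [mul_pow]; ring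
      _ ≤ _ := by gcongr

theorem le_liminf_log_measure (hC : IsCProcess μ C) {Γ : Set ℝ} {x : ℝ} (hΓ : Γ ∈ 𝓝 x) :
    -rateC x ≤ liminf (fun n : ℕ => ENNReal.log
      (μ {ω | (Real.log (C n ω : ℝ) - (n : ℝ)) / (n : ℝ) ∈ Γ}) / (n : EReal)) atTop := by
  rcases lt_or_ge (-1) x with hx | hx
  · have hx1 : 0 < x + 1 := by linarith
    have hlim : Tendsto (fun v : ℝ => ((Real.log v + 1 - (x + 1) : ℝ) : EReal))
        (𝓝[<] (x + 1)) (𝓝 ((Real.log (x + 1) + 1 - (x + 1) : ℝ) : EReal)) := by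
      refine (continuous_coe_real_ereal.tendsto _).comp (Tendsto.mono_left ?_ nhdsWithin_le_nhds)
      exact ((Real.continuousAt_log hx1.ne').add_const 1).sub_const (x + 1)
    have heq : -rateC x = ((Real.log (x + 1) + 1 - (x + 1) : ℝ) : EReal) := by
      rw [rateC_of_neg_one_lt hx, ← EReal.coe_neg]
      congr 1
      ring
    rw [heq]
    refine le_of_tendsto hlim ?_
    filter_upwards [Ioo_mem_nhdsLT hx1] with v hv
    exact hC.le_liminf_log_measure_of_lt hv.1 hv.2 (by simpa using hΓ)
  · rw [rateC_of_le_neg_one hx, EReal.neg_top]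
    exact bot_le

end IsCProcess

theorem theorem1p1 {Ω : Type*} [MeasurableSpace Ω] (μ : Measure Ω) [IsProbabilityMeasure μ]
    (C : ℕ → Ω → ℕ) (hC : IsCProcess μ C) :
    SatisfiesLDP μ (fun n ω => (Real.log (C n ω : ℝ) - (n : ℝ)) / (n : ℝ)) rateC := by
  refine ⟨RateC.isGoodRateFunction, fun Γ _ => ⟨?_, liminf_le_limsup, ?_⟩⟩
  · rw [EReal.neg_le]
    refine le_iInf₂ fun x hx => ?_
    rw [EReal.neg_le]
    exact hC.le_liminf_log_measure (mem_interior_iff_mem_nhds.1 hx)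
  · rw [← EReal.le_of_forall_lt_iff_le]
    intro b hb
    have hb' : ((-b : ℝ) : EReal) < ⨅ x ∈ closure Γ, rateC x := by
      rw [EReal.coe_neg]
      exact EReal.neg_lt_comm.1 hb
    -- The tail estimates need a positive level `-b`; for `b ≥ 0` it suffices that probabilities are
    -- at most `1`.
    rcases lt_or_ge b 0 with h0 | h0
    · have := hC.limsup_log_measure_le (Γ := Γ) (neg_pos.2 h0) fun x hx =>
        hb'.le.trans (iInf₂_le x (subset_closure hx))
      rwa [neg_neg] at this
    · refine le_trans (limsup_log_measure_div_le (r := fun _ => 0) (b := 0) (by simp) ?_)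
        (EReal.coe_le_coe_iff.2 h0)
      exact Eventually.of_forall fun n => by simp
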